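/- Let $k$ be a division ring. An additive closed symmetric monoidal structure on the category of left $k$-modules is a symmetric monoidal structure (a product $-\wedge-$, a unit object, and associativity, unit and commutativity isomorphisms satisfying the usual coherence conditions) such that $\wedge$ is additive in each variable and, for every $k$-module $A$, the functor $A\wedge -$ has a right adjoint. Two such structures are called symmetric monoidally equivalent if there is an additive equivalence from the category of left $k$-modules to itself which is a strong symmetric monoidal functor from the first structure to the second. Then: (1) If $k$ is not a field (i.e. not commutative), there is no additive closed symmetric monoidal structure on the category of left $k$-modules. (2) If $k$ is a field, there is an additive closed symmetric monoidal structure on the category of $k$-modules, and any two such structures are symmetric monoidally equivalent. -/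

import Mathlib

open CategoryTheory

universe v u

/-- An additive closed symmetric monoidal structure on a preadditive category `C`: a monoidal
structure with a symmetric braiding, whose product is additive in each variable, and such that
`X ⊗ -` has a right adjoint for every `X`. -/
structure AdditiveClosedSymmetricMonoidal (C : Type u) [Category.{v} C] [Preadditive C] where
  monoidal : MonoidalCategory C
  symmetric : SymmetricCategory C
  additive : MonoidalPreadditive C
  closed : MonoidalClosed C

/-- Two such structures on `C` are symmetric monoidally equivalent if there is an additive
equivalence of categories `C ⥤ C` that is a (strong) symmetric monoidal functor from the first
structure to the second. -/
def AdditiveClosedSymmetricMonoidal.Equivalent {C : Type u} [Category.{v} C] [Preadditive C]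
    (S T : AdditiveClosedSymmetricMonoidal C) : Prop :=
  ∃ F : C ⥤ C, F.IsEquivalence ∧ F.Additive ∧
    Nonempty (@Functor.Braided
      C _ S.monoidal S.symmetric.toBraidedCategory
      C _ T.monoidal T.symmetric.toBraidedCategory F)

/-! Endomorphisms of the unit object `I` commute by an Eckmann–Hilton argument, and additivity
forces `I` to be nonzero. Commuting rank-one maps then make `k` commutative and `I` one-dimensional,
so a noncommutative `k` admits no structure. Over a field, `I ≅ k` identifies elements of `X` with
morphisms `I ⟶ X`. Multiplying such points is bilinear and gives a coherent comparison `X ⊗ Y ⟶ X ∧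
Y` (`laxMonoidal`). It is invertible for `Y = I`, hence for every `Y`, a coproduct of copies of `I`,
because closedness makes `X ∧ -` preserve colimits (`isIso_tensorator`). Thus the identity functor
is a braided equivalence to the usual tensor product. -/

open MonoidalCategory Limits

/-! ### Commuting endomorphisms of the unit. -/

section UnitEndomorphisms

/-- Endomorphisms of the unit object of a monoidal category commute. -/
theorem tensorUnit_endomorphisms_comm {C : Type*} [Category* C] [MonoidalCategory C]
    (f g : 𝟙_ C ⟶ 𝟙_ C) : f ≫ g = g ≫ f := by
  have hf : f ▷ 𝟙_ C = (λ_ (𝟙_ C)).hom ≫ f ≫ (λ_ (𝟙_ C)).inv := by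
    rw [unitors_equal, unitors_inv_equal, ← rightUnitor_naturality_assoc]; simp
  have hg : 𝟙_ C ◁ g = (λ_ (𝟙_ C)).hom ≫ g ≫ (λ_ (𝟙_ C)).inv := by
    rw [← leftUnitor_naturality_assoc]; simp
  have h := whisker_exchange f g
  rw [hf, hg] at h
  simpa using h.symm

variable {k : Type*} [DivisionRing k] {V : Type*} [AddCommGroup V] [Module k V]

/-- Every nonzero vector is sent to `1` by some linear functional. -/
theorem exists_functional_apply_eq_one {u : V} (hu : u ≠ 0) : ∃ φ : V →ₗ[k] k, φ u = 1 := by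
  obtain ⟨φ, hφ⟩ := (LinearMap.toSpanSingleton k V u).exists_leftInverse_of_injective
    (LinearMap.ker_toSpanSingleton k hu)
  exact ⟨φ, by simpa using LinearMap.congr_fun hφ 1⟩

/-- If all endomorphisms of a nonzero vector space commute, then so do the scalars. -/
theorem mul_comm_of_end_comm [Nontrivial V] (h : ∀ f g : V →ₗ[k] V, f ∘ₗ g = g ∘ₗ f)
    (a b : k) : a * b = b * a := by
  obtain ⟨u, hu⟩ := exists_ne (0 : V)
  obtain ⟨φ, hφ⟩ := exists_functional_apply_eq_one (k := k) hu
  -- On the line through `u` these maps are right multiplication of the coefficient by `b` and by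
  -- `a`; right multiplications are linear even when `k` is noncommutative.
  have key := LinearMap.congr_fun (h (φ.smulRight (b • u)) (φ.smulRight (a • u))) u
  simp only [LinearMap.comp_apply, LinearMap.smulRight_apply, hφ, map_smul,
    one_mul, smul_smul] at key
  exact smul_left_injective k hu key

/-- If all endomorphisms of a vector space commute, then any nonzero vector spans it. -/
theorem exists_smul_eq_of_end_comm (h : ∀ f g : V →ₗ[k] V, f ∘ₗ g = g ∘ₗ f) {u : V}
    (hu : u ≠ 0) (v : V) : ∃ c : k, c • u = v := by
  obtain ⟨φ, hφ⟩ := exists_functional_apply_eq_one (k := k) hu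
  have key := LinearMap.congr_fun (h (φ.smulRight u) (φ.smulRight v)) u
  simp only [LinearMap.comp_apply, LinearMap.smulRight_apply, hφ, one_smul] at key
  exact ⟨φ v, key⟩

end UnitEndomorphisms

/-! ### Products of points. -/

section UnitPairs

variable {D : Type*} [Category* D] [MonoidalCategory D]

namespace UnitComparison

/-- The product of two morphisms from the unit object. -/
def pair {X Y : D} (f : 𝟙_ D ⟶ X) (g : 𝟙_ D ⟶ Y) : 𝟙_ D ⟶ X ⊗ Y :=
  (λ_ (𝟙_ D)).inv ≫ (f ⊗ₘ g)

/-- The two unitors of the unit agree, so a scalar can be pulled out of either factor; this gives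
bilinearity over `k`. -/
theorem pair_comp_left {X Y : D} (s : 𝟙_ D ⟶ 𝟙_ D) (f : 𝟙_ D ⟶ X) (g : 𝟙_ D ⟶ Y) :
    pair (s ≫ f) g = s ≫ pair f g := by
  rw [pair, pair, unitors_inv_equal, rightUnitor_inv_naturality_assoc, ← tensorHom_id,
    tensorHom_comp_tensorHom, Category.id_comp]

theorem pair_comp_right {X Y : D} (s : 𝟙_ D ⟶ 𝟙_ D) (f : 𝟙_ D ⟶ X) (g : 𝟙_ D ⟶ Y) :
    pair f (s ≫ g) = s ≫ pair f g := by
  rw [pair, pair, leftUnitor_inv_naturality_assoc, ← id_tensorHom,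
    tensorHom_comp_tensorHom, Category.id_comp]

theorem pair_comp_tensorHom {X Y X' Y' : D} (f : 𝟙_ D ⟶ X) (g : 𝟙_ D ⟶ Y)
    (a : X ⟶ X') (b : Y ⟶ Y') : pair f g ≫ (a ⊗ₘ b) = pair (f ≫ a) (g ≫ b) := by
  simp [pair]

theorem pair_comp_whiskerRight {X Y X' : D} (f : 𝟙_ D ⟶ X) (g : 𝟙_ D ⟶ Y)
    (a : X ⟶ X') : pair f g ≫ (a ▷ Y) = pair (f ≫ a) g := by
  rw [← tensorHom_id, pair_comp_tensorHom, Category.comp_id]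

theorem pair_comp_whiskerLeft {X Y Y' : D} (f : 𝟙_ D ⟶ X) (g : 𝟙_ D ⟶ Y)
    (b : Y ⟶ Y') : pair f g ≫ (X ◁ b) = pair f (g ≫ b) := by
  rw [← id_tensorHom, pair_comp_tensorHom, Category.comp_id]

theorem pair_id_comp_leftUnitor {X : D} (f : 𝟙_ D ⟶ X) :
    pair (𝟙 _) f ≫ (λ_ X).hom = f := by
  simp [pair]

theorem pair_id_comp_rightUnitor {X : D} (f : 𝟙_ D ⟶ X) :
    pair f (𝟙 _) ≫ (ρ_ X).hom = f := by
  simp [pair, unitors_inv_equal]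

/-- Naturality reduces the claim to identity points of the unit, where it is pure coherence. -/
theorem pair_comp_associator {X Y Z : D} (f : 𝟙_ D ⟶ X) (g : 𝟙_ D ⟶ Y) (h : 𝟙_ D ⟶ Z) :
    pair (pair f g) h ≫ (α_ X Y Z).hom = pair f (pair g h) := by
  have h₁ : pair (pair f g) h = pair (pair (𝟙 _) (𝟙 _)) (𝟙 _) ≫ ((f ⊗ₘ g) ⊗ₘ h) := by
    simp only [pair_comp_tensorHom, Category.id_comp]
  have h₂ : pair f (pair g h) = pair (𝟙 _) (pair (𝟙 _) (𝟙 _)) ≫ (f ⊗ₘ (g ⊗ₘ h)) := by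
    simp only [pair_comp_tensorHom, Category.id_comp]
  rw [h₁, h₂, Category.assoc, associator_naturality, ← Category.assoc]
  congr 1
  simp only [pair]
  monoidal_coherence

theorem pair_comp_braiding [BraidedCategory D] {X Y : D} (f : 𝟙_ D ⟶ X) (g : 𝟙_ D ⟶ Y) :
    pair f g ≫ (β_ X Y).hom = pair g f := by
  simp [pair, BraidedCategory.braiding_naturality, unitors_inv_equal]

variable [Preadditive D] [MonoidalPreadditive D]

theorem pair_add_left {X Y : D} (f f' : 𝟙_ D ⟶ X) (g : 𝟙_ D ⟶ Y) :
    pair (f + f') g = pair f g + pair f' g := by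
  simp [pair, MonoidalPreadditive.add_tensor]

theorem pair_add_right {X Y : D} (f : 𝟙_ D ⟶ X) (g g' : 𝟙_ D ⟶ Y) :
    pair f (g + g') = pair f g + pair f g' := by
  simp [pair, MonoidalPreadditive.tensor_add]

end UnitComparison

end UnitPairs

/-! ### Comparison with the tensor product over a field. -/

section Comparison

variable {k : Type u} [Field k] {D : Type*} [Category.{u} D] [MonoidalCategory D]
  (E : D ⥤ ModuleCat.{u} k)
  (e : ModuleCat.of k k ≅ E.obj (𝟙_ D))

namespace UnitComparison

/-- The element classified by a morphism from the unit object. -/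
def value {X : D} (f : 𝟙_ D ⟶ X) : E.obj X := E.map f (e.hom (1 : k))

theorem map_value {X Y : D} (f : 𝟙_ D ⟶ X) (g : X ⟶ Y) :
    E.map g (value E e f) = value E e (f ≫ g) := by
  simp [value]

theorem hom_eq_smul_value (c : k) : e.hom c = c • value E e (𝟙 _) := by
  have h : (c • (1 : ModuleCat.of k k)) = c := mul_one c
  rw [value, E.map_id, ModuleCat.id_apply, ← map_smul]
  exact congrArg e.hom h.symm

theorem value_add [Preadditive D] [E.Additive] {X : D} (f g : 𝟙_ D ⟶ X) :
    value E e (f + g) = value E e f + value E e g := by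
  simp [value, E.map_add]

theorem value_injective [E.Faithful] {X : D} :
    Function.Injective (value E e : (𝟙_ D ⟶ X) → E.obj X) := by
  intro f g h
  apply E.map_injective
  rw [← cancel_epi e.hom]
  ext
  exact h

variable [E.Full]

/-- The morphism from the unit object classifying an element. -/
noncomputable def point {X : D} (x : E.obj X) : 𝟙_ D ⟶ X :=
  E.preimage (e.inv ≫ ModuleCat.ofHom (LinearMap.toSpanSingleton k (E.obj X) x))

@[simp]
theorem value_point {X : D} (x : E.obj X) : value E e (point E e x) = x := by
  simp [value, point]

/-- Scalars act as endomorphisms of the unit object. -/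
noncomputable def scalar (c : k) : 𝟙_ D ⟶ 𝟙_ D := point E e (c • e.hom (1 : k))

theorem value_scalar_comp {X : D} (c : k) (f : 𝟙_ D ⟶ X) :
    value E e (scalar E e c ≫ f) = c • value E e f := by
  rw [← map_value, scalar, value_point, map_smul]
  rfl

variable [E.Faithful]

@[simp]
theorem point_value {X : D} (f : 𝟙_ D ⟶ X) : point E e (value E e f) = f :=
  value_injective E e (value_point E e _)

theorem point_map {X Y : D} (x : E.obj X) (g : X ⟶ Y) :
    point E e (E.map g x) = point E e x ≫ g :=
  value_injective E e (by rw [← map_value]; simp)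

theorem point_smul {X : D} (c : k) (x : E.obj X) :
    point E e (c • x) = scalar E e c ≫ point E e x :=
  value_injective E e (by simp [value_scalar_comp])

variable [Preadditive D] [E.Additive]

theorem point_add {X : D} (x y : E.obj X) :
    point E e (x + y) = point E e x + point E e y :=
  value_injective E e (by simp [value_add])

variable [MonoidalPreadditive D]

/-- The comparison map from the tensor product of vector spaces. -/
noncomputable def tensorator (X Y : D) : E.obj X ⊗ E.obj Y ⟶ E.obj (X ⊗ Y) :=
  ModuleCat.MonoidalCategory.tensorLift
    (fun x y => value E e (pair (point E e x) (point E e y)))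
    (fun x x' y => by rw [point_add, pair_add_left, value_add])
    (fun c x y => by rw [point_smul, pair_comp_left, value_scalar_comp])
    (fun x y y' => by rw [point_add, pair_add_right, value_add])
    (fun c x y => by rw [point_smul, pair_comp_right, value_scalar_comp])

open scoped TensorProduct

theorem tensorator_tmul {X Y : D} (x : E.obj X) (y : E.obj Y) :
    tensorator E e X Y (x ⊗ₜ[k] y) = value E e (pair (point E e x) (point E e y)) := rfl

/-- The functor `E` is lax monoidal when the unit object corresponds to the ground field. -/
@[reducible]
noncomputable def laxMonoidal : E.LaxMonoidal where
  ε := e.hom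
  μ := tensorator E e
  μ_natural_left f X' := ModuleCat.MonoidalCategory.tensor_ext fun x y => by
    change tensorator E e _ _ (E.map f x ⊗ₜ[k] y) = E.map (f ▷ X') (tensorator E e _ _ (x ⊗ₜ[k] y))
    rw [tensorator_tmul, tensorator_tmul, map_value, point_map, pair_comp_whiskerRight]
  μ_natural_right X' f := ModuleCat.MonoidalCategory.tensor_ext fun x y => by
    change tensorator E e _ _ (x ⊗ₜ[k] E.map f y) = E.map (X' ◁ f) (tensorator E e _ _ (x ⊗ₜ[k] y))
    rw [tensorator_tmul, tensorator_tmul, map_value, point_map, pair_comp_whiskerLeft]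
  associativity X Y Z := ModuleCat.MonoidalCategory.tensor_ext₃' fun x y z => by
    change E.map (α_ X Y Z).hom
        (tensorator E e _ _ (tensorator E e _ _ (x ⊗ₜ[k] y) ⊗ₜ[k] z)) =
      tensorator E e _ _ (x ⊗ₜ[k] tensorator E e _ _ (y ⊗ₜ[k] z))
    simp only [tensorator_tmul, map_value, point_value, pair_comp_associator]
  left_unitality X := ModuleCat.MonoidalCategory.tensor_ext fun c x => by
    change c • x = E.map (λ_ X).hom (tensorator E e _ _ (e.hom c ⊗ₜ[k] x))
    rw [hom_eq_smul_value, TensorProduct.smul_tmul]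
    rw [TensorProduct.tmul_smul, map_smul, tensorator_tmul, map_smul, map_value, point_value,
      pair_id_comp_leftUnitor, value_point]
  right_unitality X := ModuleCat.MonoidalCategory.tensor_ext fun x c => by
    change c • x = E.map (ρ_ X).hom (tensorator E e _ _ (x ⊗ₜ[k] e.hom c))
    rw [hom_eq_smul_value, TensorProduct.tmul_smul, map_smul, tensorator_tmul, map_smul,
      map_value, point_value, pair_id_comp_rightUnitor, value_point]

theorem tensorator_braiding [BraidedCategory D] (X Y : D) :
    tensorator E e X Y ≫ E.map (β_ X Y).hom =
      (β_ (E.obj X) (E.obj Y)).hom ≫ tensorator E e Y X :=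
  ModuleCat.MonoidalCategory.tensor_ext fun x y => by
    change E.map (β_ X Y).hom (tensorator E e _ _ (x ⊗ₜ[k] y)) = tensorator E e _ _ (y ⊗ₜ[k] x)
    rw [tensorator_tmul, tensorator_tmul, map_value, pair_comp_braiding]

/-- The right unit axiom writes this map as a composite of isomorphisms. -/
theorem isIso_tensorator_unit (X : D) : IsIso (tensorator E e X (𝟙_ D)) := by
  let := laxMonoidal E e
  have h := Functor.LaxMonoidal.right_unitality E X
  have h' : tensorator E e X (𝟙_ D) = (E.obj X ◁ e.inv) ≫ (ρ_ (E.obj X)).hom ≫ E.map (ρ_ X).inv := by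
    rw [h]
    change _ = _ ≫ (_ ◁ e.hom ≫ tensorator E e _ _ ≫ _) ≫ _
    simp [← E.map_comp]
  rw [h']
  infer_instance

/-- Every object is a coproduct of copies of the unit object, indexed by a basis. -/
noncomputable def isColimitOfBasis {Y : D} {ι : Type*} (b : Module.Basis ι k (E.obj Y)) :
    IsColimit (Cofan.mk Y fun i => point E e (b i)) :=
  Cofan.IsColimit.mk _
    (fun s => E.preimage (ModuleCat.ofHom (b.constr k fun i => value E e (s.inj i))))
    (fun s i => value_injective E e (by
      rw [← map_value]
      simp [Cofan.inj]))
    (fun s m hm => E.map_injective (by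
      ext1
      refine b.ext fun i => ?_
      have := congrArg (value E e) (hm i)
      rw [← map_value] at this
      simpa [Cofan.inj] using this))

/-- The tensorator as a natural transformation in its second variable. -/
noncomputable def tensoratorNatTrans (X : D) :
    E ⋙ tensorLeft (E.obj X) ⟶ tensorLeft X ⋙ E where
  app Y := tensorator E e X Y
  naturality _ _ f := (laxMonoidal E e).μ_natural_right X f

/-- Both sides preserve colimits in `Y`, so invertibility spreads from the unit to coproducts of its
copies. -/
theorem isIso_tensorator [E.IsEquivalence] [MonoidalClosed D] (X Y : D) :
    IsIso (tensorator E e X Y) := by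
  let b := Module.Basis.ofVectorSpace k (E.obj Y)
  let K : Discrete (Module.Basis.ofVectorSpaceIndex k (E.obj Y)) ⥤ D :=
    Discrete.functor fun _ => 𝟙_ D
  have (j : Discrete (Module.Basis.ofVectorSpaceIndex k (E.obj Y))) :
      IsIso ((Functor.whiskerLeft K (tensoratorNatTrans E e X)).app j) :=
    isIso_tensorator_unit E e X
  have : IsIso (Functor.whiskerLeft K (tensoratorNatTrans E e X)) :=
    NatIso.isIso_of_isIso_app _
  exact isIso_app_coconePt_of_preservesColimit K (tensoratorNatTrans E e X) _
    (isColimitOfBasis E e b)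

/-- The functor `E` is strong braided when the unit object corresponds to the ground field. -/
@[reducible]
noncomputable def braided [E.IsEquivalence] [MonoidalClosed D] [BraidedCategory D] : E.Braided :=
  letI := laxMonoidal E e
  haveI : IsIso (Functor.LaxMonoidal.ε E) := inferInstanceAs (IsIso e.hom)
  haveI (X Y : D) : IsIso (Functor.LaxMonoidal.μ E X Y) := isIso_tensorator E e X Y
  { toMonoidal := Functor.Monoidal.ofLaxMonoidal E
    braided := tensorator_braiding E e }

end UnitComparison

end Comparison

/-! ### Inverses of braided equivalences. -/

section Inverse

variable {C D : Type*} [Category* C] [Category* D] [MonoidalCategory C] [MonoidalCategory D]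
  [BraidedCategory C] [BraidedCategory D]

/-- The inverse of a braided equivalence is braided. -/
@[reducible]
noncomputable def inverseBraided (e : C ≌ D) [e.functor.Braided] : e.inverse.Braided :=
  letI := e.inverseMonoidal
  { toMonoidal := e.inverseMonoidal
    braided X Y := by
      have hμ (X Y : D) : Functor.LaxMonoidal.μ e.inverse X Y = e.unit.app _ ≫
          e.inverse.map (Functor.OplaxMonoidal.δ e.functor _ _ ≫
            (e.counit.app X ⊗ₘ e.counit.app Y)) := rfl
      have hδ : Functor.OplaxMonoidal.δ e.functor (e.inverse.obj X) (e.inverse.obj Y) ≫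
          (β_ _ _).hom = e.functor.map (β_ _ _).hom ≫
            Functor.OplaxMonoidal.δ e.functor (e.inverse.obj Y) (e.inverse.obj X) := by
        simp
      have hβ : (e.counit.app X ⊗ₘ e.counit.app Y) ≫ (β_ X Y).hom =
          (β_ (e.functor.obj (e.inverse.obj X)) (e.functor.obj (e.inverse.obj Y))).hom ≫
            (e.counit.app Y ⊗ₘ e.counit.app X) :=
        BraidedCategory.braiding_naturality _ _
      rw [hμ, hμ, Category.assoc, ← e.inverse.map_comp, Category.assoc,
        hβ, reassoc_of% hδ, e.inverse.map_comp,
        ← Category.assoc, ← Category.assoc]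
      congr 1
      exact (e.unit.naturality _).symm }

end Inverse

/-! ### Structures on vector spaces. -/

section Classification

/-- The unit object of an additive monoidal structure on vector spaces is nonzero. -/
theorem nontrivial_tensorUnit {k : Type u} [DivisionRing k] [MonoidalCategory (ModuleCat.{u} k)]
    [MonoidalPreadditive (ModuleCat.{u} k)] : Nontrivial (𝟙_ (ModuleCat.{u} k) : ModuleCat k) := by
  by_contra h
  rw [not_nontrivial_iff_subsingleton] at h
  have h₁ : 𝟙 (𝟙_ (ModuleCat.{u} k)) = 0 := by ext x; exact Subsingleton.elim _ _
  -- The left unitor turns the identity of `k` into the whiskering of the zero map `𝟙 I`.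
  have h₂ : 𝟙 (ModuleCat.of k k) = 0 := by
    rw [← cancel_epi (λ_ (ModuleCat.of k k)).hom, Category.comp_id, comp_zero,
      ← Category.id_comp (λ_ (ModuleCat.of k k)).hom, ← id_whiskerRight, h₁,
      MonoidalPreadditive.zero_whiskerRight, zero_comp]
  have := congrArg (fun f => f.hom (1 : k)) h₂
  exact one_ne_zero this

theorem tensorUnit_end_comm {k : Type u} [Ring k] [MonoidalCategory (ModuleCat.{u} k)]
    (f g : (𝟙_ (ModuleCat.{u} k) : ModuleCat k) →ₗ[k] (𝟙_ (ModuleCat.{u} k) : ModuleCat k)) :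
    f ∘ₗ g = g ∘ₗ f :=
  congrArg ModuleCat.Hom.hom (tensorUnit_endomorphisms_comm (ModuleCat.ofHom g) (ModuleCat.ofHom f))

/-- The unit object is one-dimensional. -/
theorem nonempty_iso_tensorUnit {k : Type u} [DivisionRing k] [MonoidalCategory (ModuleCat.{u} k)]
    [MonoidalPreadditive (ModuleCat.{u} k)] :
    Nonempty (ModuleCat.of k k ≅ 𝟙_ (ModuleCat.{u} k)) := by
  have := nontrivial_tensorUnit (k := k)
  obtain ⟨u, hu⟩ := exists_ne (0 : (𝟙_ (ModuleCat.{u} k) : ModuleCat k))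
  refine ⟨(LinearEquiv.ofBijective (LinearMap.toSpanSingleton k _ u)
    ⟨smul_left_injective k hu, exists_smul_eq_of_end_comm tensorUnit_end_comm hu⟩).toModuleIso⟩

namespace AdditiveClosedSymmetricMonoidal

variable {C : Type u} [Category.{v} C] [Preadditive C] {S T U : AdditiveClosedSymmetricMonoidal C}

theorem Equivalent.symm (h : S.Equivalent T) : T.Equivalent S := by
  obtain ⟨F, hF, hA, ⟨hB⟩⟩ := h
  have : F.asEquivalence.functor.Additive := hA
  refine ⟨F.inv, inferInstance, F.asEquivalence.inverse_additive, ⟨?_⟩⟩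
  exact @inverseBraided C C _ _ S.monoidal T.monoidal S.symmetric.toBraidedCategory
    T.symmetric.toBraidedCategory F.asEquivalence hB

theorem Equivalent.trans (h : S.Equivalent T) (h' : T.Equivalent U) : S.Equivalent U := by
  obtain ⟨F, hF, hA, ⟨hB⟩⟩ := h
  obtain ⟨G, hG, hA', ⟨hB'⟩⟩ := h'
  refine ⟨F ⋙ G, inferInstance, inferInstance, ⟨?_⟩⟩
  exact @Functor.Braided.instComp C _ S.monoidal S.symmetric.toBraidedCategory
    C _ T.monoidal T.symmetric.toBraidedCategory C _ U.monoidal U.symmetric.toBraidedCategory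
    F G hB hB'

/-- The usual tensor product of vector spaces. -/
noncomputable def tensorProduct (k : Type u) [Field k] :
    AdditiveClosedSymmetricMonoidal (ModuleCat.{u} k) where
  monoidal := inferInstance
  symmetric := inferInstance
  additive := inferInstance
  closed := inferInstance

theorem equivalent_tensorProduct {k : Type u} [Field k]
    (S : AdditiveClosedSymmetricMonoidal (ModuleCat.{u} k)) : S.Equivalent (tensorProduct k) := by
  obtain ⟨e⟩ := @nonempty_iso_tensorUnit k _ S.monoidal S.additive
  exact ⟨𝟭 _, inferInstance, inferInstance,
    ⟨@UnitComparison.braided k _ (ModuleCat.{u} k) _ S.monoidal (𝟭 _) e _ _ _ _ S.additive _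
      S.closed S.symmetric.toBraidedCategory⟩⟩

end AdditiveClosedSymmetricMonoidal

end Classification

theorem theorem3p3 (k : Type u) [DivisionRing k] :
    (¬ IsField k → IsEmpty (AdditiveClosedSymmetricMonoidal (ModuleCat.{u} k))) ∧
    (IsField k →
      Nonempty (AdditiveClosedSymmetricMonoidal (ModuleCat.{u} k)) ∧
      ∀ S T : AdditiveClosedSymmetricMonoidal (ModuleCat.{u} k), S.Equivalent T) := by
  constructor
  · refine fun hk => ⟨fun S => hk ?_⟩
    let := S.monoidal
    have := S.additive
    have := nontrivial_tensorUnit (k := k)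
    exact ⟨exists_pair_ne k, mul_comm_of_end_comm tensorUnit_end_comm,
      fun h => ⟨_, mul_inv_cancel₀ h⟩⟩
  · intro hk
    -- Substituting along this equality keeps the module category literally the same.
    obtain ⟨F, rfl⟩ : ∃ F : Field k, F.toDivisionRing = ‹DivisionRing k› :=
      ⟨{ ‹DivisionRing k› with mul_comm := hk.mul_comm }, rfl⟩
    exact ⟨⟨.tensorProduct k⟩, fun S T =>
      S.equivalent_tensorProduct.trans T.equivalent_tensorProduct.symm⟩
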